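/- Let $\hat{\mathbb Z}=\varprojlim_m \mathbb Z/m\mathbb Z$ be the ring of profinite integers, and give $\mathrm{GL}_2(\hat{\mathbb Z})$ its profinite topology. For each prime $\ell$ let $\pi_\ell\colon \mathrm{GL}_2(\hat{\mathbb Z})\to \mathrm{GL}_2(\mathbb Z_\ell)$ be the map induced by the projection $\hat{\mathbb Z}\to\mathbb Z_\ell=\varprojlim_k\mathbb Z/\ell^k\mathbb Z$. Let $\mathrm{sgn}\colon \mathrm{GL}_2(\hat{\mathbb Z})\to\{\pm1\}$ be the homomorphism that sends a matrix to the sign of the permutation which its reduction modulo $2$, an element of $\mathrm{GL}_2(\mathbb F_2)$, induces on the three nonzero vectors of $\mathbb F_2^2$. Let $\det\colon \mathrm{GL}_2(\hat{\mathbb Z})\to\hat{\mathbb Z}^{*}$ be the determinant. **Theorem.** Let $H\subseteq \mathrm{GL}_2(\hat{\mathbb Z})$ be a closed subgroup. Then $H=\mathrm{GL}_2(\hat{\mathbb Z})$ if and only if both of the following conditions hold: (i) the restriction $\pi_\ell\colon H\to \mathrm{GL}_2(\mathbb Z_\ell)$ is surjective for every prime $\ell$; (ii) the restriction $(\mathrm{sgn},\det)\colon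 H\to\{\pm1\}\times\hat{\mathbb Z}^{*}$ is surjective. -/

import Mathlib

open scoped MatrixGroups

/-- The ring of profinite integers: the inverse limit of the rings `ℤ/mℤ` over the positive
integers `m` ordered by divisibility, realised as the subring of compatible families in the product
of all `ℤ/mℤ`. -/
def ZHatSubring : Subring (∀ m : ℕ+, ZMod (m : ℕ)) where
  carrier := {x | ∀ (m n : ℕ+) (h : (m : ℕ) ∣ (n : ℕ)),
    ZMod.castHom h (ZMod (m : ℕ)) (x n) = x m}
  mul_mem' := fun hx hy m n h => by
    simp only [Pi.mul_apply, map_mul, hx m n h, hy m n h]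
  one_mem' := fun m n h => by simp only [Pi.one_apply, map_one]
  add_mem' := fun hx hy m n h => by
    simp only [Pi.add_apply, map_add, hx m n h, hy m n h]
  zero_mem' := fun m n h => by simp only [Pi.zero_apply, map_zero]
  neg_mem' := fun hx m n h => by
    simp only [Pi.neg_apply, map_neg, hx m n h]

/-- The profinite integers. The topology is the profinite one, namely the subspace topology of the
product of the discrete rings `ℤ/mℤ`. Then `GL (Fin 2) ZHat` has its topology as the group of units
of the topological ring of matrices over `ZHat`. -/
abbrev ZHat : Type := ZHatSubring

namespace ZHat

/-- The reduction map from the profinite integers to `ℤ/mℤ`. -/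
def toZMod (m : ℕ+) : ZHat →+* ZMod (m : ℕ) :=
  (Pi.evalRingHom (fun m : ℕ+ => ZMod (m : ℕ)) m).comp ZHatSubring.subtype

/-- The reduction map from the profinite integers to `ℤ/p^kℤ`. -/
def toZModPow (p : ℕ) [hp : Fact p.Prime] (k : ℕ) : ZHat →+* ZMod (p ^ k) :=
  toZMod ⟨p ^ k, pow_pos hp.out.pos k⟩

theorem toZModPow_compat (p : ℕ) [hp : Fact p.Prime] (k₁ k₂ : ℕ) (hk : k₁ ≤ k₂) :
    (ZMod.castHom (pow_dvd_pow p hk) (ZMod (p ^ k₁))).comp (toZModPow p k₂) = toZModPow p k₁ :=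
  RingHom.ext fun x => x.2 ⟨p ^ k₁, pow_pos hp.out.pos k₁⟩ ⟨p ^ k₂, pow_pos hp.out.pos k₂⟩
    (pow_dvd_pow p hk)

/-- The projection from the profinite integers to the `p`-adic integers: the unique ring
homomorphism compatible with the reductions modulo all powers of `p`. -/
noncomputable def toPadicInt (p : ℕ) [Fact p.Prime] : ZHat →+* ℤ_[p] :=
  PadicInt.lift (f := toZModPow p) (toZModPow_compat p)

theorem toZModPow_toPadicInt (p : ℕ) [Fact p.Prime] (k : ℕ) (x : ZHat) :
    PadicInt.toZModPow k (toPadicInt p x) = toZModPow p k x :=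
  RingHom.congr_fun (PadicInt.lift_spec (toZModPow_compat p) k) x

end ZHat

/-- The projection `π_p` from `GL₂` of the profinite integers to `GL₂(ℤ_p)`. -/
noncomputable def GL2ZHat.proj (p : ℕ) [Fact p.Prime] : GL (Fin 2) ZHat →* GL (Fin 2) ℤ_[p] :=
  Matrix.GeneralLinearGroup.map (ZHat.toPadicInt p)

/-- The permutation of the set of nonzero vectors of `R²` given by an invertible matrix. -/
def GL2.permNonzero (R : Type*) [CommRing R] :
    GL (Fin 2) R →* Equiv.Perm {v : Fin 2 → R // v ≠ 0} where
  toFun g :=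
    { toFun := fun v => ⟨g.1.mulVec v.1, fun h => v.2 (by
        have := congrArg (g⁻¹).1.mulVec h
        rwa [Matrix.mulVec_mulVec, Units.inv_mul, Matrix.one_mulVec, Matrix.mulVec_zero] at this)⟩
      invFun := fun v => ⟨(g⁻¹).1.mulVec v.1, fun h => v.2 (by
        have := congrArg g.1.mulVec h
        rwa [Matrix.mulVec_mulVec, Units.mul_inv, Matrix.one_mulVec, Matrix.mulVec_zero] at this)⟩
      left_inv := fun v => Subtype.ext (by
        simp only [Matrix.mulVec_mulVec, Units.inv_mul, Matrix.one_mulVec])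
      right_inv := fun v => Subtype.ext (by
        simp only [Matrix.mulVec_mulVec, Units.mul_inv, Matrix.one_mulVec]) }
  map_one' := Equiv.ext fun v => Subtype.ext (Matrix.one_mulVec v.1)
  map_mul' g h := Equiv.ext fun v => Subtype.ext (Matrix.mulVec_mulVec v.1 g.1 h.1).symm

/-- The sign of an element of `GL₂(𝔽₂)`, as a permutation of the three nonzero vectors of `𝔽₂²`. -/
def GL2F2.sgn : GL (Fin 2) (ZMod 2) →* ℤˣ :=
  Equiv.Perm.sign.comp (GL2.permNonzero (ZMod 2))

/-- The sign on `GL₂` of the profinite integers: reduce modulo 2 and take the sign. -/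
def GL2ZHat.sgn : GL (Fin 2) ZHat →* ℤˣ :=
  GL2F2.sgn.comp (Matrix.GeneralLinearGroup.map (ZHat.toZMod 2))

/-- The homomorphism `(sgn, det)` from `GL₂` of the profinite integers to the product of `{±1}` and
the unit group of the profinite integers. -/
def GL2ZHat.sgnDet : GL (Fin 2) ZHat →* ℤˣ × ZHatˣ :=
  GL2ZHat.sgn.prod Matrix.GeneralLinearGroup.det

/-! A closed subgroup is determined by its images modulo all `m`, so it suffices that `H` surjects
onto every `GL₂(ℤ/m)`. Write `m = pⁿa` with `a` prime to `p` and induct: `GL₂(ℤ/m)` is the product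
of `GL₂(ℤ/pⁿ)` and `GL₂(ℤ/a)`, and the image of `H` surjects onto the first factor by (i) and onto
the second by induction. By Goursat, it is a fibre product over a common quotient `Q` of the
factors.

Condition (ii) makes the image of `H` surject onto the abelianization of `GL₂(ℤ/m)`, since the
determinant, together with the sign when `m` is even, detects that abelianization
(`GL2.mem_commutator_of_det_eq_one`). This forces `Q` to be perfect. But `GL₂(ℤ/pⁿ)` has no
nontrivial perfect quotient (`GL2.noPerfectQuotient_prime_pow`), so `Q` is trivial. For `n = 1`, a
normal subgroup surjecting onto the abelianization contains a nontrivial elementary matrix, hence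
`SL₂`, hence everything; higher powers add only abelian kernels. -/

/-! ### Perfect quotients and Goursat's lemma -/

/-- A group has no nontrivial perfect quotient if every normal subgroup that surjects onto the
abelianization is the whole group. -/
def NoPerfectQuotient (A : Type*) [Group A] : Prop :=
  ∀ N : Subgroup A, N.Normal → N ⊔ commutator A = ⊤ → N = ⊤

theorem Subgroup.exists_mem_map_eq_of_sup_commutator {A C : Type*} [Group A] [CommGroup C]
    {N : Subgroup A} (hN : N ⊔ _root_.commutator A = ⊤) (χ : A →* C) (a : A) :
    ∃ n ∈ N, χ n = χ a := by
  have ha : a ∈ N ⊔ _root_.commutator A := hN ▸ Subgroup.mem_top a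
  obtain ⟨n, hn, c, hc, rfl⟩ := Subgroup.mem_sup_of_normal_right.1 ha
  refine ⟨n, hn, ?_⟩
  have : χ c = 1 := Abelianization.commutator_subset_ker χ hc
  rw [map_mul, this, mul_one]

/-- The image of `N` in `B` is everything, so `A = N · ker f`. Hence `A ⧸ N` is a quotient of the
abelian group `ker f`, and being also perfect it is trivial. -/
theorem NoPerfectQuotient.of_commute_ker {A B : Type*} [Group A] [Group B] (hB : NoPerfectQuotient B)
    (f : A →* B) (hf : Function.Surjective f)
    (hker : ∀ x y, f x = 1 → f y = 1 → x * y = y * x) : NoPerfectQuotient A := by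
  intro N hN hsup
  have hfN : N.map f = ⊤ := by
    refine hB _ (hN.map f hf) ?_
    have h := congrArg (Subgroup.map f) hsup
    rw [Subgroup.map_sup, commutator_def, Subgroup.map_commutator,
      Subgroup.map_top_of_surjective f hf] at h
    rwa [commutator_def]
  have hcov : ∀ a : A, ∃ n ∈ N, ∃ k, f k = 1 ∧ a = n * k := fun a => by
    obtain ⟨n, hn, hna⟩ := Subgroup.mem_map.1 (hfN ▸ Subgroup.mem_top (f a))
    exact ⟨n, hn, n⁻¹ * a, by simp [hna], by group⟩
  have hcomm : ∀ a b : A, (a : A ⧸ N) * b = b * a := fun a b => by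
    obtain ⟨n, hn, k, hk, rfl⟩ := hcov a
    obtain ⟨m, hm, l, hl, rfl⟩ := hcov b
    have h1 : (n : A ⧸ N) = 1 := (QuotientGroup.eq_one_iff n).2 hn
    have h2 : (m : A ⧸ N) = 1 := (QuotientGroup.eq_one_iff m).2 hm
    simp only [QuotientGroup.mk_mul, h1, h2, one_mul]
    rw [← QuotientGroup.mk_mul, ← QuotientGroup.mk_mul, hker k l hk hl]
  have hle : commutator A ≤ N := by
    rw [commutator_def, Subgroup.commutator_le]
    intro a _ b _
    rw [← QuotientGroup.eq_one_iff, commutatorElement_def]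
    simp only [QuotientGroup.mk_mul, QuotientGroup.mk_inv, hcomm a b]
    group
  rwa [sup_eq_left.2 hle] at hsup

/-- A form of Goursat's lemma: a subgroup of a product that surjects onto both factors and onto the
abelianization is everything, provided that one factor has no nontrivial perfect quotient. -/
theorem NoPerfectQuotient.eq_top_of_map_eq_top {G A B : Type*} [Group G] [Group A] [Group B]
    (hA : NoPerfectQuotient A) (f : G →* A) (g : G →* B)
    (hinj : ∀ x, f x = 1 → g x = 1 → x = 1) (hsurj : ∀ a, ∃ x, f x = a ∧ g x = 1)
    {H : Subgroup G} (hHf : H.map f = ⊤) (hHg : H.map g = ⊤) (hH : H ⊔ commutator G = ⊤) :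
    H = ⊤ := by
  -- This is the Goursat subgroup of `A`; it is normal because `H` surjects onto `A`.
  have hN : (H ⊓ g.ker).map f = ⊤ := by
    refine hA _ ⟨?_⟩ ?_
    · rintro _ ⟨n, ⟨hnH, hng⟩, rfl⟩ a
      obtain ⟨h, hh, rfl⟩ := Subgroup.mem_map.1 (hHf ▸ Subgroup.mem_top a)
      refine ⟨h * n * h⁻¹, ⟨H.mul_mem (H.mul_mem hh hnH) (H.inv_mem hh), ?_⟩, by simp⟩
      exact (inferInstance : g.ker.Normal).conj_mem n hng h
    · rw [eq_top_iff]
      intro a _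
      obtain ⟨x, rfl, hgx⟩ := hsurj a
      obtain ⟨h, hh, c, hc, rfl⟩ := Subgroup.mem_sup_of_normal_right.1 (hH ▸ Subgroup.mem_top x)
      -- Since `g` maps `H` onto `B`, the commutator part `c` can be replaced by some `c'` in `⁅H,
      -- H⁆` with the same image in `B`. Then `h * c'` lies in `H ⊓ g.ker`, and its image in `A`
      -- differs from `f x` by a commutator.
      have hgc : g c ∈ (⁅H, H⁆ : Subgroup G).map g := by
        rw [Subgroup.map_commutator, hHg]
        have := Subgroup.mem_map_of_mem g hc
        rw [commutator_def, Subgroup.map_commutator] at this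
        exact Subgroup.commutator_mono le_top le_top this
      obtain ⟨c', hc', hcc'⟩ := hgc
      have hc'H : c' ∈ H := H.commutator_le_self hc'
      have hfc : ∀ y ∈ commutator G, f y ∈ commutator A := fun y hy => by
        have := Subgroup.mem_map_of_mem f hy
        rw [commutator_def, Subgroup.map_commutator] at this
        exact Subgroup.commutator_mono le_top le_top this
      have hfc' : f c' ∈ commutator A :=
        hfc _ (Subgroup.commutator_mono le_top le_top hc')
      have key : f (h * c) = f (h * c') * ((f c')⁻¹ * f c) := by simp only [map_mul]; group
      rw [key]
      refine Subgroup.mul_mem_sup (Subgroup.mem_map_of_mem f ⟨H.mul_mem hh hc'H, ?_⟩)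
        (Subgroup.mul_mem _ (Subgroup.inv_mem _ hfc') (hfc c hc))
      change g (h * c') = 1
      rw [map_mul, hcc', ← map_mul, hgx]
  rw [eq_top_iff]
  intro x _
  obtain ⟨h, hh, hhx⟩ := Subgroup.mem_map.1 (hHg ▸ Subgroup.mem_top (g x))
  obtain ⟨k, ⟨hkH, hkg⟩, hkx⟩ := Subgroup.mem_map.1 (hN ▸ Subgroup.mem_top (f (h⁻¹ * x)))
  have : k⁻¹ * (h⁻¹ * x) = 1 := by
    apply hinj
    · rw [map_mul, map_inv, hkx, inv_mul_cancel]
    · have hkg' : g k = 1 := hkg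
      simp [hkg', hhx]
  have hx : x = h * k := by
    rw [inv_mul_eq_one] at this
    rw [this]; group
  exact hx ▸ H.mul_mem hh hkH

/-! ### Elementary matrices and the abelianization of `GL₂(ℤ/m)` -/

namespace GL2

variable {R S : Type*} [CommRing R] [CommRing S]

/-- The upper unitriangular elementary matrix. -/
def upper (t : R) : GL (Fin 2) R :=
  ⟨!![1, t; 0, 1], !![1, -t; 0, 1], by simp [Matrix.one_fin_two], by simp [Matrix.one_fin_two]⟩

/-- The lower unitriangular elementary matrix. -/
def lower (t : R) : GL (Fin 2) R :=
  ⟨!![1, 0; t, 1], !![1, 0; -t, 1], by simp [Matrix.one_fin_two], by simp [Matrix.one_fin_two]⟩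

/-- The diagonal matrix with entries `u` and `1`. -/
def diagOne (u : Rˣ) : GL (Fin 2) R :=
  ⟨!![(u : R), 0; 0, 1], !![((u⁻¹ : Rˣ) : R), 0; 0, 1],
    by simp [Matrix.one_fin_two], by simp [Matrix.one_fin_two]⟩

/-- The matrix exchanging the two basis vectors. -/
def swap : GL (Fin 2) R :=
  ⟨!![0, 1; 1, 0], !![0, 1; 1, 0], by simp [Matrix.one_fin_two], by simp [Matrix.one_fin_two]⟩

theorem val_upper (t : R) : (upper t).1 = !![1, t; 0, 1] := rfl
theorem val_lower (t : R) : (lower t).1 = !![1, 0; t, 1] := rfl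
theorem val_diagOne (u : Rˣ) : (diagOne u).1 = !![(u : R), 0; 0, 1] := rfl
theorem val_swap : (swap : GL (Fin 2) R).1 = !![0, 1; 1, 0] := rfl
theorem val_diagOne_inv (u : Rˣ) : (diagOne u)⁻¹.1 = !![((u⁻¹ : Rˣ) : R), 0; 0, 1] := rfl

theorem upper_add (s t : R) : upper (s + t) = upper s * upper t := by
  apply Units.ext; simp [val_upper, add_comm]

theorem upper_zero : upper (0 : R) = 1 := by
  apply Units.ext; simp [val_upper, Matrix.one_fin_two]

theorem upper_neg (t : R) : upper (-t) = (upper t)⁻¹ := by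
  rw [eq_inv_iff_mul_eq_one, ← upper_add, neg_add_cancel, upper_zero]

theorem upper_natCast (n : ℕ) : upper (n : R) = upper 1 ^ n := by
  induction n with
  | zero => simp [upper_zero]
  | succ n ih => rw [Nat.cast_succ, upper_add, ih, pow_succ]

theorem swap_inv : (swap : GL (Fin 2) R)⁻¹ = swap := rfl

theorem swap_conj_upper (t : R) : swap * upper t * swap⁻¹ = lower t := by
  rw [swap_inv]; apply Units.ext; simp [val_upper, val_lower, val_swap]

theorem diagOne_conj_upper (u : Rˣ) (t : R) :
    diagOne u * upper t * (diagOne u)⁻¹ = upper (u * t) := by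
  rw [mul_inv_eq_iff_eq_mul]; apply Units.ext; simp [val_upper, val_diagOne]

theorem det_upper (t : R) : Matrix.GeneralLinearGroup.det (upper t) = 1 := by
  apply Units.ext; simp [val_upper, Matrix.det_fin_two]

theorem det_lower (t : R) : Matrix.GeneralLinearGroup.det (lower t) = 1 := by
  apply Units.ext; simp [val_lower, Matrix.det_fin_two]

theorem det_diagOne (u : Rˣ) : Matrix.GeneralLinearGroup.det (diagOne u) = u := by
  apply Units.ext; simp [val_diagOne, Matrix.det_fin_two]

theorem map_upper (f : R →+* S) (t : R) :
    Matrix.GeneralLinearGroup.map f (upper t) = upper (f t) := by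
  apply Units.ext; ext i j; fin_cases i <;> fin_cases j <;> simp [val_upper]

theorem map_diagOne (f : R →+* S) (u : Rˣ) :
    Matrix.GeneralLinearGroup.map f (diagOne u) = diagOne (Units.map f u) := by
  apply Units.ext; ext i j; fin_cases i <;> fin_cases j <;> simp [val_diagOne]

theorem val_eq (x : GL (Fin 2) R) : x.1 = !![x.1 0 0, x.1 0 1; x.1 1 0, x.1 1 1] :=
  Matrix.eta_fin_two x.1

/-- An upper triangular matrix of determinant `1` is a product of elementary matrices. -/
theorem mem_of_det_eq_one_of_apply_eq_zero {K : Subgroup (GL (Fin 2) R)}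
    (hu : ∀ t, upper t ∈ K) (hl : ∀ t, lower t ∈ K) (x : GL (Fin 2) R)
    (hx : Matrix.GeneralLinearGroup.det x = 1) (h0 : x.1 1 0 = 0) : x ∈ K := by
  have hd : x.1 0 0 * x.1 1 1 = 1 := by
    have := congrArg Units.val hx
    simpa [Matrix.det_fin_two, h0] using this
  -- With `d = a⁻¹`, the product of the last six factors is `diag(a, d)`: the Weyl element with
  -- entries `a`, `-d`, times the inverse of the standard one.
  have : x = upper (x.1 0 1 * x.1 0 0) * (upper (x.1 0 0) * lower (-x.1 1 1) * upper (x.1 0 0) *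
      (upper (-1) * lower 1 * upper (-1))) := by
    apply Units.ext
    conv_lhs => rw [val_eq x, h0]
    generalize x.1 0 0 = a at *
    generalize x.1 0 1 = b at *
    generalize x.1 1 1 = d at *
    simp only [Units.val_mul, val_upper, val_lower]
    ext i j
    fin_cases i <;> fin_cases j <;> simp <;> grind
  rw [this]
  exact K.mul_mem (hu _) (K.mul_mem (K.mul_mem (K.mul_mem (hu _) (hl _)) (hu _))
    (K.mul_mem (K.mul_mem (hu _) (hl _)) (hu _)))

/-- Over `ℤ/mℤ`, matrices of determinant `1` are products of elementary matrices. -/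
theorem mem_of_det_eq_one {m : ℕ} [NeZero m] {K : Subgroup (GL (Fin 2) (ZMod m))}
    (hu : ∀ t, upper t ∈ K) (hl : ∀ t, lower t ∈ K) (x : GL (Fin 2) (ZMod m))
    (hx : Matrix.GeneralLinearGroup.det x = 1) : x ∈ K := by
  -- Subtractive Euclidean algorithm on natural representatives of the first column; their sum is
  -- the quantity that decreases.
  have key : ∀ s a c : ℕ, a + c = s → ∀ x : GL (Fin 2) (ZMod m),
      Matrix.GeneralLinearGroup.det x = 1 → x.1 0 0 = a → x.1 1 0 = c → x ∈ K := by
    intro s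
    induction s using Nat.strong_induction_on with
    | _ s ih =>
    rintro a c rfl x hx ha hc
    rcases Nat.eq_zero_or_pos c with rfl | hc0
    · exact mem_of_det_eq_one_of_apply_eq_zero hu hl x hx (by simpa using hc)
    rcases Nat.eq_zero_or_pos a with rfl | ha0
    · have : lower (-1) * (upper 1 * x) ∈ K := by
        refine mem_of_det_eq_one_of_apply_eq_zero hu hl _ ?_ ?_
        · rw [map_mul, map_mul, det_lower, det_upper, hx, one_mul, one_mul]
        · rw [Units.val_mul, Units.val_mul, val_eq x, ha, val_upper, val_lower]
          simp
      exact (K.mul_mem_cancel_left (hu 1)).1 ((K.mul_mem_cancel_left (hl _)).1 this)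
    rcases le_total c a with h | h
    · refine (K.mul_mem_cancel_left (hu (-1))).1 (ih a (by omega) (a - c) c (by omega) _ ?_ ?_ ?_)
      · rw [map_mul, det_upper, hx, one_mul]
      · simp [val_upper, Matrix.mul_apply, ha, hc, Nat.cast_sub h, sub_eq_add_neg]
      · simp [val_upper, Matrix.mul_apply, hc]
    · refine (K.mul_mem_cancel_left (hl (-1))).1 (ih c (by omega) a (c - a) (by omega) _ ?_ ?_ ?_)
      · rw [map_mul, det_lower, hx, one_mul]
      · simp [val_lower, Matrix.mul_apply, ha]
      · simp [val_lower, Matrix.mul_apply, ha, hc, Nat.cast_sub h, sub_eq_add_neg, add_comm]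
  exact key _ (x.1 0 0).val (x.1 1 0).val rfl x hx (by simp) (by simp)

theorem sgn_upper_one : GL2F2.sgn (upper 1) = -1 := by decide

/-- In `GL₂(ℤ/mℤ)`, the kernel of the determinant and the sign lies in the commutator subgroup. -/
theorem mem_commutator_of_det_eq_one {m : ℕ} [NeZero m] (x : GL (Fin 2) (ZMod m))
    (hx : Matrix.GeneralLinearGroup.det x = 1)
    (hs : ∀ h : 2 ∣ m, GL2F2.sgn (Matrix.GeneralLinearGroup.map (ZMod.castHom h (ZMod 2)) x) = 1) :
    x ∈ commutator (GL (Fin 2) (ZMod m)) := by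
  let φ : GL (Fin 2) (ZMod m) →* Abelianization (GL (Fin 2) (ZMod m)) := Abelianization.of
  have hconj : ∀ g y, φ (g * y * g⁻¹) = φ y := fun g y => by
    rw [map_mul, map_mul, map_inv, mul_comm (φ g), mul_inv_cancel_right]
  -- Conjugation by `diag(-1, 1)` inverts `upper 1`, so its class has order at most two.
  have hsq : φ (upper 1) * φ (upper 1) = 1 := by
    have h := hconj (diagOne (-1)) (upper 1)
    rw [diagOne_conj_upper, Units.val_neg, Units.val_one, neg_one_mul, upper_neg, map_inv] at h
    rw [mul_eq_one_iff_eq_inv, h]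
  have hu : ∀ t, upper t ∈ (Subgroup.zpowers (φ (upper 1))).comap φ := fun t => by
    rw [Subgroup.mem_comap, ← ZMod.natCast_zmod_val t, upper_natCast, map_pow]
    exact Subgroup.npow_mem_zpowers _ _
  have hl : ∀ t, lower t ∈ (Subgroup.zpowers (φ (upper 1))).comap φ := fun t => by
    rw [Subgroup.mem_comap, ← swap_conj_upper, hconj]
    exact hu t
  obtain ⟨k, hk⟩ := mem_of_det_eq_one hu hl x hx
  have hφ : φ x = 1 ∨ φ x = φ (upper 1) := by
    simp only at hk
    rw [← hk]
    rcases Int.even_or_odd' k with ⟨l, rfl | rfl⟩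
    · left; rw [zpow_mul, zpow_two, hsq, one_zpow]
    · right; rw [zpow_add, zpow_mul, zpow_two, hsq, one_zpow, zpow_one, one_mul]
  rw [← Abelianization.ker_of, MonoidHom.mem_ker]
  rcases hφ with h | h
  · exact h
  -- For even `m` the sign is `-1` on `upper 1`, which excludes the second case. For odd `m` the
  -- class of `upper 1` is killed by both `2` and `m`, so it is trivial.
  by_cases h2 : 2 ∣ m
  · exfalso
    let χ : GL (Fin 2) (ZMod m) →* ℤˣ :=
      GL2F2.sgn.comp (Matrix.GeneralLinearGroup.map (ZMod.castHom h2 (ZMod 2)))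
    have hχ : ∀ y, Abelianization.lift χ (φ y) = χ y := fun y => Abelianization.lift_apply_of χ y
    have h1 : χ x = χ (upper 1) := by rw [← hχ, ← hχ, h]
    have h3 : χ (upper 1) = -1 := by
      change GL2F2.sgn (Matrix.GeneralLinearGroup.map _ (upper 1)) = -1
      rw [map_upper, map_one, sgn_upper_one]
    have h4 : χ x = 1 := hs h2
    rw [h4, h3] at h1
    exact absurd h1 (by decide)
  · have hm : φ (upper 1) ^ m = 1 := by
      rw [← map_pow, ← upper_natCast, ZMod.natCast_self, upper_zero, map_one]
    obtain ⟨l, rfl⟩ := Nat.not_even_iff_odd.1 (fun h => h2 h.two_dvd)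
    rw [pow_succ, pow_mul, sq, hsq, one_pow, one_mul] at hm
    exact h.trans hm

end GL2

/-! ### Normal subgroups of `GL₂` over a field -/

namespace GL2

section Field

variable {F : Type*} [Field F] {N : Subgroup (GL (Fin 2) F)}

theorem upper_mem_of_upper_mem (hN : N.Normal) {t : F} (ht : t ≠ 0) (h : upper t ∈ N) (s : F) :
    upper s ∈ N := by
  by_cases hs : s = 0
  · rw [hs, upper_zero]; exact N.one_mem
  have := hN.conj_mem _ h (diagOne (Units.mk0 (s / t) (div_ne_zero hs ht)))
  rwa [diagOne_conj_upper, Units.val_mk0, div_mul_cancel₀ s ht] at this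

/-- A non-scalar matrix is conjugate to one with zero upper left entry and nonzero lower left
entry. -/
theorem exists_conj_apply_eq_zero (n : GL (Fin 2) F)
    (hn : ¬ (n.1 0 1 = 0 ∧ n.1 1 0 = 0 ∧ n.1 0 0 = n.1 1 1)) :
    ∃ g : GL (Fin 2) F, (g * n * g⁻¹).1 0 0 = 0 ∧ (g * n * g⁻¹).1 1 0 ≠ 0 := by
  have step1 : ∃ g : GL (Fin 2) F, (g * n * g⁻¹).1 1 0 ≠ 0 := by
    by_cases hc : n.1 1 0 = 0
    · by_cases hb : n.1 0 1 = 0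
      · refine ⟨lower 1, ?_⟩
        have had : n.1 0 0 - n.1 1 1 ≠ 0 := fun h => hn ⟨hb, hc, sub_eq_zero.1 h⟩
        have : (lower 1 * n * (lower 1)⁻¹).1 1 0 = n.1 0 0 - n.1 1 1 := by
          rw [Units.val_mul, Units.val_mul, val_eq n, hb, hc]
          change (!![1, 0; 1, 1] * !![n.1 0 0, 0; 0, n.1 1 1] * !![1, 0; -1, 1] :
            Matrix (Fin 2) (Fin 2) F) 1 0 = _
          simp [sub_eq_add_neg]
        rwa [this]
      · refine ⟨swap, ?_⟩
        have : (swap * n * swap⁻¹).1 1 0 = n.1 0 1 := by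
          rw [Units.val_mul, Units.val_mul, val_eq n]
          change (!![0, 1; 1, 0] * !![n.1 0 0, n.1 0 1; n.1 1 0, n.1 1 1] * !![0, 1; 1, 0] :
            Matrix (Fin 2) (Fin 2) F) 1 0 = _
          simp
        rwa [this]
    · exact ⟨1, by simpa using hc⟩
  obtain ⟨g, hg⟩ := step1
  set x := g * n * g⁻¹ with hx
  -- The left factor clears the upper left entry; the right factor does not change the first column.
  have h1 : (upper (-(x.1 0 0 / x.1 1 0)) * x * (upper (-(x.1 0 0 / x.1 1 0)))⁻¹).1 0 0 = 0 := by
    rw [← upper_neg, Units.val_mul, Units.val_mul, val_eq x, val_upper, val_upper]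
    simp [div_mul_cancel₀ _ hg]
  have h2 : (upper (-(x.1 0 0 / x.1 1 0)) * x * (upper (-(x.1 0 0 / x.1 1 0)))⁻¹).1 1 0
      = x.1 1 0 := by
    rw [← upper_neg, Units.val_mul, Units.val_mul, val_eq x, val_upper, val_upper]
    simp
  refine ⟨upper (-(x.1 0 0 / x.1 1 0)) * g, ?_⟩
  have h3 : upper (-(x.1 0 0 / x.1 1 0)) * g * n * (upper (-(x.1 0 0 / x.1 1 0)) * g)⁻¹ =
      upper (-(x.1 0 0 / x.1 1 0)) * x * (upper (-(x.1 0 0 / x.1 1 0)))⁻¹ := by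
    rw [hx]; group
  rw [h3, h1, h2]
  exact ⟨rfl, hg⟩

theorem exists_mem_apply_eq_zero (hN : N.Normal) {n : GL (Fin 2) F} (hnN : n ∈ N)
    (hn : ¬ (n.1 0 1 = 0 ∧ n.1 1 0 = 0 ∧ n.1 0 0 = n.1 1 1)) {C : Type*} [CommGroup C]
    (χ : GL (Fin 2) F →* C) :
    ∃ x ∈ N, χ x = χ n ∧ x.1 0 0 = 0 ∧ x.1 1 0 ≠ 0 := by
  obtain ⟨g, h0, h1⟩ := exists_conj_apply_eq_zero n hn
  refine ⟨_, hN.conj_mem n hnN g, ?_, h0, h1⟩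
  rw [map_mul, map_mul, map_inv, mul_comm (χ g), mul_inv_cancel_right]

/-- The commutator with `diag(u, 1)` of a matrix with zero upper left entry is upper triangular. -/
theorem exists_mem_upper_triangular (hN : N.Normal) {n : GL (Fin 2) F} (hnN : n ∈ N)
    (h0 : n.1 0 0 = 0) (h1 : n.1 1 0 ≠ 0) (u : Fˣ) :
    ∃ q ∈ N, q.1 = !![((u⁻¹ : Fˣ) : F), n.1 1 1 / n.1 1 0 * (1 - u); 0, (u : F)] := by
  refine ⟨n⁻¹ * (diagOne u * n * (diagOne u)⁻¹),
    N.mul_mem (N.inv_mem hnN) (hN.conj_mem n hnN _), ?_⟩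
  have hdet : n.1 0 1 ≠ 0 := fun h => by
    have hd := (Matrix.GeneralLinearGroup.det n).ne_zero
    rw [Matrix.GeneralLinearGroup.val_det_apply, Matrix.det_fin_two] at hd
    simp [h, h0] at hd
  set q : Matrix (Fin 2) (Fin 2) F :=
    !![((u⁻¹ : Fˣ) : F), n.1 1 1 / n.1 1 0 * (1 - u); 0, (u : F)] with hq
  -- Checking `n * q` against the conjugate avoids computing the inverse of `n`.
  have hmul : n.1 * q = (diagOne u * n * (diagOne u)⁻¹).1 := by
    rw [Units.val_mul, Units.val_mul, val_diagOne, val_diagOne_inv, val_eq n, h0, hq]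
    ext i j
    fin_cases i <;> fin_cases j <;> simp <;> field_simp
    ring
  rw [Units.val_mul, ← hmul, ← mul_assoc, ← Units.val_mul, inv_mul_cancel, Units.val_one, one_mul]

/-- The upper triangular element of `N` with diagonal `(u⁻¹, u)` rescales `upper 1` by `u⁻²` under
conjugation, so its commutator with `upper 1` is elementary, and nontrivial as `u² ≠ 1`. No such `u`
exists over fields with two or three elements. -/
theorem exists_upper_mem (hN : N.Normal) {n : GL (Fin 2) F} (hnN : n ∈ N)
    (h0 : n.1 0 0 = 0) (h1 : n.1 1 0 ≠ 0) {u : Fˣ} (hu : (u : F) ^ 2 ≠ 1) :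
    ∃ t : F, t ≠ 0 ∧ upper t ∈ N := by
  obtain ⟨q, hqN, hq⟩ := exists_mem_upper_triangular hN hnN h0 h1 u
  refine ⟨1 - ((u⁻¹ : Fˣ) : F) ^ 2, sub_ne_zero.2 fun h => hu ?_, ?_⟩
  · have h2 : (u⁻¹ : Fˣ) ^ 2 = 1 := Units.ext (by simpa using h.symm)
    rw [inv_pow, inv_eq_one] at h2
    simpa using congrArg Units.val h2
  have key : upper (1 - ((u⁻¹ : Fˣ) : F) ^ 2) = upper 1 * q * (upper 1)⁻¹ * q⁻¹ := by
    rw [eq_mul_inv_iff_mul_eq, eq_mul_inv_iff_mul_eq]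
    apply Units.ext
    rw [Units.val_mul, Units.val_mul, Units.val_mul, hq, val_upper, val_upper]
    ext i j
    fin_cases i <;> fin_cases j <;> simp
    field_simp
    ring
  rw [key]
  exact N.mul_mem (hN.conj_mem q hqN _) (N.inv_mem hqN)

end Field

/-! ### Perfect quotients of `GL₂(𝔽_p)` -/

section Prime

variable (p : ℕ) [Fact p.Prime]

/-- Conjugation yields all elementary matrices, hence `SL₂`, and `N` already attains every
determinant because it surjects onto the abelianization. -/
theorem eq_top_of_upper_mem {N : Subgroup (GL (Fin 2) (ZMod p))} (hN : N.Normal)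
    (hsup : N ⊔ commutator (GL (Fin 2) (ZMod p)) = ⊤) {t : ZMod p} (ht : t ≠ 0)
    (h : upper t ∈ N) : N = ⊤ := by
  have hu := upper_mem_of_upper_mem hN ht h
  have hl : ∀ s, lower s ∈ N := fun s => swap_conj_upper s ▸ hN.conj_mem _ (hu s) swap
  rw [eq_top_iff]
  intro x _
  obtain ⟨n, hn, hdet⟩ :=
    Subgroup.exists_mem_map_eq_of_sup_commutator hsup Matrix.GeneralLinearGroup.det x
  refine (N.mul_mem_cancel_left (N.inv_mem hn)).1 (mem_of_det_eq_one hu hl _ ?_)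
  rw [map_mul, map_inv, hdet, inv_mul_cancel]

/-- Scalar matrices have square determinant, so an element of `N` with nonsquare determinant is
non-scalar and can be conjugated to the required shape. -/
theorem exists_mem_not_isSquare {p : ℕ} [Fact p.Prime] (hp : p ≠ 2)
    {N : Subgroup (GL (Fin 2) (ZMod p))} (hN : N.Normal)
    (hsup : N ⊔ commutator (GL (Fin 2) (ZMod p)) = ⊤) :
    ∃ n ∈ N, ¬ IsSquare (n.1.det) ∧ n.1 0 0 = 0 ∧ n.1 1 0 ≠ 0 := by
  obtain ⟨d, hd⟩ := FiniteField.exists_nonsquare (F := ZMod p) (by rwa [ZMod.ringChar_zmod_n])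
  have hd0 : d ≠ 0 := fun h => hd (h ▸ IsSquare.zero)
  obtain ⟨n, hn, hdet⟩ := Subgroup.exists_mem_map_eq_of_sup_commutator hsup
    Matrix.GeneralLinearGroup.det (diagOne (Units.mk0 d hd0))
  have hdn : n.1.det = d := by
    have := congrArg Units.val hdet
    rwa [det_diagOne] at this
  obtain ⟨x, hx, hdx, h0, h1⟩ := exists_mem_apply_eq_zero hN hn (fun ⟨hb, hc, had⟩ => hd (by
    rw [← hdn, Matrix.det_fin_two, hb, hc, had]
    exact ⟨n.1 1 1, by simp⟩)) Matrix.GeneralLinearGroup.det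
  refine ⟨x, hx, ?_, h0, h1⟩
  have hxn : x.1.det = n.1.det := congrArg Units.val hdx
  rwa [hxn, hdn]

/-- An odd element of `N` is a transposition, and all transpositions are conjugate to `upper 1`. The
entry `x.1 1 1` decides: if it is `1`, then `x` has order three and is even. -/
theorem noPerfectQuotient_two : NoPerfectQuotient (GL (Fin 2) (ZMod 2)) := by
  intro N hN hsup
  obtain ⟨n, hn, hs⟩ := Subgroup.exists_mem_map_eq_of_sup_commutator hsup GL2F2.sgn (upper 1)
  rw [sgn_upper_one] at hs
  have h2 : ∀ z : ZMod 2, z ≠ 0 → z = 1 := by decide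
  obtain ⟨x, hx, hsx, h0, h1⟩ := exists_mem_apply_eq_zero hN hn (fun ⟨hb, hc, had⟩ => by
    have hn1 : n = 1 := by
      have hd := (Matrix.GeneralLinearGroup.det n).ne_zero
      rw [Matrix.GeneralLinearGroup.val_det_apply, Matrix.det_fin_two, hb, hc, had] at hd
      apply Units.ext
      rw [val_eq n, hb, hc, had, h2 (n.1 1 1) (fun h => hd (by simp [h]))]
      simp [Matrix.one_fin_two]
    rw [hn1, map_one] at hs
    exact absurd hs (by decide)) GL2F2.sgn
  rw [hs] at hsx
  have hb : x.1 0 1 ≠ 0 := fun h => by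
    have hd := (Matrix.GeneralLinearGroup.det x).ne_zero
    rw [Matrix.GeneralLinearGroup.val_det_apply, Matrix.det_fin_two, h, h0] at hd
    simp at hd
  have hxv := val_eq x
  rw [h0, h2 _ h1, h2 _ hb] at hxv
  by_cases hd : x.1 1 1 = 0
  · rw [hd] at hxv
    have hxs : x = swap := Units.ext hxv
    refine eq_top_of_upper_mem 2 hN hsup (t := 1) one_ne_zero ?_
    have hc := hN.conj_mem _ hx (lower 1)
    have : upper 1 = lower 1 * x * (lower 1)⁻¹ := by rw [hxs]; decide
    rwa [this]
  · rw [h2 _ hd] at hxv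
    have hx3 : x * x * x = 1 := by
      apply Units.ext
      rw [Units.val_mul, Units.val_mul, hxv]
      decide
    have := congrArg GL2F2.sgn hx3
    rw [map_mul, map_mul, hsx, map_one] at this
    exact absurd this (by decide)

theorem two_ne_zero_zmod_three : (2 : ZMod 3) ≠ 0 := by decide

theorem eq_one_of_not_isSquare_neg : ∀ z : ZMod 3, ¬ IsSquare (-z) → z = 1 := by decide

theorem eq_of_mul_eq_one_zmod_three :
    ∀ b c : ZMod 3, b * c = 1 → (b = 1 ∧ c = 1) ∨ (b = 2 ∧ c = 2) := by decide

/-- Every unit of `𝔽₃` squares to `1`, so `exists_upper_mem` is unavailable. If the trace of `n` is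
nonzero, taking `u = -1` gives a matrix with diagonal `(-1, -1)` whose square is elementary. If the
trace vanishes, `n` is `swap` or its negative, and an explicit commutator is `upper 2`. -/
theorem noPerfectQuotient_three : NoPerfectQuotient (GL (Fin 2) (ZMod 3)) := by
  intro N hN hsup
  obtain ⟨n, hn, hsq, h0, h1⟩ := exists_mem_not_isSquare (by norm_num) hN hsup
  have hbc : n.1 0 1 * n.1 1 0 = 1 := by
    rw [Matrix.det_fin_two, h0, zero_mul, zero_sub] at hsq
    exact eq_one_of_not_isSquare_neg _ hsq
  by_cases hd : n.1 1 1 = 0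
  · have hc := hN.conj_mem _ hn (lower 1)
    have hq := N.mul_mem (hN.conj_mem _ hc (upper 1)) (N.inv_mem hc)
    refine eq_top_of_upper_mem 3 hN hsup (t := 2) two_ne_zero_zmod_three ?_
    convert hq using 1
    have hnv := val_eq n
    rw [h0, hd] at hnv
    rcases eq_of_mul_eq_one_zmod_three _ _ hbc with ⟨hb, hc⟩ | ⟨hb, hc⟩
    · rw [hb, hc] at hnv
      obtain rfl : n = swap := Units.ext hnv
      decide
    · rw [hb, hc] at hnv
      obtain rfl : n = ⟨!![0, 2; 2, 0], !![0, 2; 2, 0], by decide, by decide⟩ := Units.ext hnv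
      decide
  · obtain ⟨q, hqN, hq⟩ := exists_mem_upper_triangular hN hn h0 h1 (-1)
    refine eq_top_of_upper_mem 3 hN hsup (t := n.1 1 1 / n.1 1 0 * 2)
      (mul_ne_zero (div_ne_zero hd h1) two_ne_zero_zmod_three) ?_
    convert N.mul_mem hqN hqN using 1
    apply Units.ext
    rw [Units.val_mul, hq, val_upper]
    have h3 : (3 : ZMod 3) = 0 := rfl
    ext i j
    fin_cases i <;> fin_cases j <;> simp
    linear_combination (2 * (n.1 1 1 / n.1 1 0)) * h3

theorem noPerfectQuotient_prime : NoPerfectQuotient (GL (Fin 2) (ZMod p)) := by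
  have hp : p.Prime := Fact.out
  by_cases h2 : p = 2
  · subst h2; exact noPerfectQuotient_two
  by_cases h3 : p = 3
  · subst h3; exact noPerfectQuotient_three
  intro N hN hsup
  obtain ⟨n, hn, -, h0, h1⟩ := exists_mem_not_isSquare h2 hN hsup
  have hne : ∀ q : ℕ, q.Prime → p ≠ q → (q : ZMod p) ≠ 0 := fun q hq hpq h =>
    hpq ((Nat.prime_dvd_prime_iff_eq hp hq).1 ((ZMod.natCast_eq_zero_iff q p).1 h))
  -- For `p ≥ 5` the unit `u = 2` works, as `2² - 1 = 3` is nonzero.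
  obtain ⟨t, ht, hup⟩ := exists_upper_mem hN hn h0 h1
    (u := Units.mk0 2 (by exact_mod_cast hne 2 Nat.prime_two h2)) (by
      rw [Units.val_mk0]
      intro h
      apply hne 3 Nat.prime_three h3
      push_cast
      linear_combination h)
  exact eq_top_of_upper_mem p hN hsup ht hup

end Prime

end GL2

/-! ### Prime powers and the Chinese remainder theorem -/

namespace GL2

/-- Any entrywise lift is invertible, because a local homomorphism reflects the unit property of the
determinant. -/
theorem map_surjective_of_isLocalHom {R S : Type*} [CommRing R] [CommRing S] (f : R →+* S)
    [IsLocalHom f] (hf : Function.Surjective f) :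
    Function.Surjective (Matrix.GeneralLinearGroup.map (n := Fin 2) f) := by
  intro y
  choose g hg using hf
  have hgy : f.mapMatrix (y.1.map g) = y.1 := by
    ext i j; simp [hg]
  have hdet : IsUnit (y.1.map g).det := by
    refine isUnit_of_map_unit f _ ?_
    rw [RingHom.map_det, hgy]
    exact (Matrix.GeneralLinearGroup.det y).isUnit
  exact ⟨Matrix.GeneralLinearGroup.mk'' _ hdet, Units.ext hgy⟩

theorem map_sub_one_apply {R S : Type*} [CommRing R] [CommRing S] (f : R →+* S)
    {x : GL (Fin 2) R} (hx : Matrix.GeneralLinearGroup.map f x = 1) (i j : Fin 2) :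
    f ((x.1 - 1) i j) = 0 := by
  have h : f.mapMatrix x.1 = 1 := congrArg Units.val hx
  have h' : f.mapMatrix (x.1 - 1) = 0 := by rw [map_sub, h, map_one, sub_self]
  exact congrFun (congrFun h' i) j

variable (p : ℕ) [hp : Fact p.Prime]

theorem map_toZModPow_surjective {n : ℕ} (hn : 0 < n) :
    Function.Surjective
      (Matrix.GeneralLinearGroup.map (n := Fin 2) (PadicInt.toZModPow (p := p) n)) := by
  have hs : Function.Surjective (PadicInt.toZModPow (p := p) n) := ZMod.ringHom_surjective _
  -- Positivity of `n` enters here: a surjection from the local ring `ℤ_[p]` is local only if its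
  -- target is nonzero.
  have : Nontrivial (ZMod (p ^ n)) := ZMod.nontrivial_iff.2 (Nat.one_lt_pow hn.ne' hp.out.one_lt).ne'
  have := IsLocalHom.of_surjective _ hs
  exact map_surjective_of_isLocalHom _ hs

theorem map_castHom_pow_surjective {m n : ℕ} (hm : 0 < m) (hmn : m ≤ n) :
    Function.Surjective (Matrix.GeneralLinearGroup.map (n := Fin 2)
      (ZMod.castHom (pow_dvd_pow p hmn) (ZMod (p ^ m)))) := by
  intro y
  obtain ⟨x, rfl⟩ := map_toZModPow_surjective p hm y
  refine ⟨Matrix.GeneralLinearGroup.map (PadicInt.toZModPow n) x, ?_⟩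
  rw [← MonoidHom.comp_apply, ← Matrix.GeneralLinearGroup.map_comp,
    PadicInt.zmod_cast_comp_toZModPow m n hmn]

theorem castHom_mul_eq_zero {n : ℕ} (a b : ZMod (p ^ (n + 2)))
    (ha : ZMod.castHom (pow_dvd_pow p (n + 1).le_succ) (ZMod (p ^ (n + 1))) a = 0)
    (hb : ZMod.castHom (pow_dvd_pow p (n + 1).le_succ) (ZMod (p ^ (n + 1))) b = 0) :
    a * b = 0 := by
  have : NeZero (p ^ (n + 2)) := ⟨(pow_pos hp.out.pos _).ne'⟩
  rw [← ZMod.natCast_zmod_val a, map_natCast, ZMod.natCast_eq_zero_iff] at ha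
  rw [← ZMod.natCast_zmod_val b, map_natCast, ZMod.natCast_eq_zero_iff] at hb
  rw [← ZMod.natCast_zmod_val a, ← ZMod.natCast_zmod_val b, ← Nat.cast_mul,
    ZMod.natCast_eq_zero_iff]
  refine dvd_trans ?_ (mul_dvd_mul ha hb)
  rw [← pow_add]
  exact pow_dvd_pow p (by omega)

/-- Modulo `p ^ (n + 2)`, the matrices congruent to `1` modulo `p ^ (n + 1)` commute, since the
products of their differences from `1` vanish. So `NoPerfectQuotient.of_commute_ker` climbs from
each exponent to the next. -/
theorem noPerfectQuotient_prime_pow (n : ℕ) :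
    NoPerfectQuotient (GL (Fin 2) (ZMod (p ^ (n + 1)))) := by
  induction n with
  | zero => rw [zero_add, pow_one]; exact noPerfectQuotient_prime p
  | succ n ih =>
    refine ih.of_commute_ker _
      (map_castHom_pow_surjective p n.succ_pos (n + 1).le_succ) fun x y hx hy => ?_
    set f := ZMod.castHom (pow_dvd_pow p (n + 1).le_succ) (ZMod (p ^ (n + 1)))
    have hmul : ∀ x y : GL (Fin 2) (ZMod (p ^ (n + 1 + 1))),
        Matrix.GeneralLinearGroup.map f x = 1 → Matrix.GeneralLinearGroup.map f y = 1 →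
        (x.1 - 1) * (y.1 - 1) = 0 := fun x y hx hy => by
      ext i j
      rw [Matrix.mul_apply]
      exact Finset.sum_eq_zero fun k _ =>
        castHom_mul_eq_zero p _ _ (map_sub_one_apply f hx i k) (map_sub_one_apply f hy k j)
    apply Units.ext
    have h : x.1 * y.1 - y.1 * x.1 = (x.1 - 1) * (y.1 - 1) - (y.1 - 1) * (x.1 - 1) := by
      noncomm_ring
    rw [hmul x y hx hy, hmul y x hy hx, sub_zero, sub_eq_zero] at h
    exact h

/-- Matrices over `ℤ/(mn)ℤ` for coprime `m` and `n` with prescribed reduction modulo `m` and trivial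
reduction modulo `n`. -/
theorem exists_map_castHom_eq {m n : ℕ} (h : m.Coprime n) (a : GL (Fin 2) (ZMod m)) :
    ∃ x : GL (Fin 2) (ZMod (m * n)),
      Matrix.GeneralLinearGroup.map (ZMod.castHom (dvd_mul_right m n) (ZMod m)) x = a ∧
      Matrix.GeneralLinearGroup.map (ZMod.castHom (dvd_mul_left n m) (ZMod n)) x = 1 := by
  let e := ZMod.chineseRemainder h
  have h1 : ∀ z, ZMod.castHom (dvd_mul_right m n) (ZMod m) z = (e z).1 := fun z =>
    RingHom.congr_fun (Subsingleton.elim _ ((RingHom.fst _ _).comp e.toRingHom)) z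
  have h2 : ∀ z, ZMod.castHom (dvd_mul_left n m) (ZMod n) z = (e z).2 := fun z =>
    RingHom.congr_fun (Subsingleton.elim _ ((RingHom.snd _ _).comp e.toRingHom)) z
  let X : Matrix (Fin 2) (Fin 2) (ZMod (m * n)) :=
    Matrix.of fun i j => e.symm (a.1 i j, (1 : Matrix (Fin 2) (Fin 2) (ZMod n)) i j)
  have hX1 : (ZMod.castHom (dvd_mul_right m n) (ZMod m)).mapMatrix X = a.1 := by
    ext i j; simp only [X, RingHom.mapMatrix_apply, Matrix.map_apply, h1]; simp
  have hX2 : (ZMod.castHom (dvd_mul_left n m) (ZMod n)).mapMatrix X = 1 := by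
    ext i j; simp only [X, RingHom.mapMatrix_apply, Matrix.map_apply, h2]; simp
  have hdet : IsUnit X.det := by
    rw [← MulEquiv.isUnit_map e, Prod.isUnit_iff, ← h1, ← h2, RingHom.map_det, RingHom.map_det,
      hX1, hX2, Matrix.det_one]
    exact ⟨(Matrix.GeneralLinearGroup.det a).isUnit, isUnit_one⟩
  exact ⟨Matrix.GeneralLinearGroup.mk'' X hdet, Units.ext hX1, Units.ext hX2⟩

theorem eq_one_of_map_castHom_eq_one {m n : ℕ} (h : m.Coprime n) (x : GL (Fin 2) (ZMod (m * n)))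
    (hm : Matrix.GeneralLinearGroup.map (ZMod.castHom (dvd_mul_right m n) (ZMod m)) x = 1)
    (hn : Matrix.GeneralLinearGroup.map (ZMod.castHom (dvd_mul_left n m) (ZMod n)) x = 1) :
    x = 1 := by
  let e := ZMod.chineseRemainder h
  have h1 : ∀ z, ZMod.castHom (dvd_mul_right m n) (ZMod m) z = (e z).1 := fun z =>
    RingHom.congr_fun (Subsingleton.elim _ ((RingHom.fst _ _).comp e.toRingHom)) z
  have h2 : ∀ z, ZMod.castHom (dvd_mul_left n m) (ZMod n) z = (e z).2 := fun z =>
    RingHom.congr_fun (Subsingleton.elim _ ((RingHom.snd _ _).comp e.toRingHom)) z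
  refine Units.ext (sub_eq_zero.1 ?_)
  ext i j
  apply e.injective
  have hm' := map_sub_one_apply _ hm i j
  have hn' := map_sub_one_apply _ hn i j
  rw [h1] at hm'
  rw [h2] at hn'
  exact (Prod.ext hm' hn').trans (map_zero e).symm

end GL2

/-! ### Lifting to the profinite integers -/

namespace ZHat

theorem castHom_toZMod {m n : ℕ+} (h : (m : ℕ) ∣ n) (x : ZHat) :
    ZMod.castHom h (ZMod (m : ℕ)) (toZMod n x) = toZMod m x :=
  x.2 m n h

theorem ext_toZMod {x y : ZHat} (h : ∀ m, toZMod m x = toZMod m y) : x = y :=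
  Subtype.ext (funext h)

open scoped Nat in
/-- Units modulo `m` lift to units of the profinite integers. -/
theorem unitsMap_toZMod_surjective (m : ℕ+) :
    Function.Surjective (Units.map (toZMod m : ZHat →* ZMod (m : ℕ))) := by
  intro u
  have hne : ∀ j : ℕ, NeZero ((m : ℕ) * j !) := fun j =>
    ⟨mul_ne_zero m.ne_zero (Nat.factorial_ne_zero j)⟩
  have hd : ∀ j k : ℕ, j ≤ k → (m : ℕ) * j ! ∣ m * k ! := fun j k h =>
    mul_dvd_mul_left _ (Nat.factorial_dvd_factorial h)
  have hs : ∀ (j : ℕ) (v : (ZMod ((m : ℕ) * j !))ˣ), ∃ w : (ZMod ((m : ℕ) * (j + 1)!))ˣ,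
      ZMod.unitsMap (hd j (j + 1) j.le_succ) w = v := fun j v =>
    ZMod.unitsMap_surjective _ v
  choose g hg using hs
  have h0 : (m : ℕ) * 0 ! ∣ m := by simp
  -- Units are lifted step by step along the chain `m * j!`, which is cofinal for divisibility; the
  -- residue modulo `n` is then read off at `j = n`.
  let a : ∀ j, (ZMod ((m : ℕ) * j !))ˣ := fun j => Nat.rec (ZMod.unitsMap h0 u) g j
  have ha : ∀ j k (h : j ≤ k), ZMod.unitsMap (hd j k h) (a k) = a j := by
    intro j k h
    induction k, h using Nat.le_induction with
    | base => exact ZMod.unitsMap_self _ ▸ rfl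
    | succ k h ih =>
      rw [← ih, ← hg k (a k), ← MonoidHom.comp_apply, ZMod.unitsMap_comp]
  have hn : ∀ n : ℕ+, (n : ℕ) ∣ m * (n : ℕ)! := fun n =>
    Dvd.dvd.mul_left (Nat.dvd_factorial n.pos le_rfl) _
  let x : ∀ n : ℕ+, (ZMod (n : ℕ))ˣ := fun n => ZMod.unitsMap (hn n) (a n)
  have hx : ∀ (k n : ℕ+) (h : (k : ℕ) ∣ n), ZMod.unitsMap h (x n) = x k := by
    intro k n h
    simp only [x]
    rw [← ha k n (Nat.le_of_dvd n.pos h), ← MonoidHom.comp_apply, ← MonoidHom.comp_apply,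
      ZMod.unitsMap_comp, ZMod.unitsMap_comp]
  refine ⟨⟨⟨fun n => x n, fun k n h => congrArg Units.val (hx k n h)⟩,
    ⟨fun n => (x n)⁻¹.1, fun k n h => ?_⟩, ?_, ?_⟩, ?_⟩
  · exact congrArg (fun v : (ZMod (k : ℕ))ˣ => (v⁻¹).1) (hx k n h)
  · exact Subtype.ext (funext fun n => (x n).mul_inv)
  · exact Subtype.ext (funext fun n => (x n).inv_mul)
  · apply Units.ext
    change (x m).1 = u
    have hm : (m : ℕ) ∣ m * 0 ! := by simp
    have := congrArg (ZMod.unitsMap hm) (ha 0 m (Nat.zero_le _))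
    have h2 : ZMod.unitsMap hm (a 0) = u := by
      change ZMod.unitsMap hm (ZMod.unitsMap h0 u) = u
      rw [← MonoidHom.comp_apply, ZMod.unitsMap_comp, ZMod.unitsMap_self]; rfl
    rw [h2, ← MonoidHom.comp_apply, ZMod.unitsMap_comp] at this
    exact congrArg Units.val this

variable (p : ℕ) [hp : Fact p.Prime]

/-- A profinite integer vanishes if its `p`-adic component and its reductions modulo all integers
prime to `p` vanish. -/
theorem eq_zero_of_toPadicInt_eq_zero {s : ZHat} (hs : toPadicInt p s = 0)
    (hm : ∀ m : ℕ+, p.Coprime m → toZMod m s = 0) : s = 0 := by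
  refine ext_toZMod fun n => ?_
  obtain ⟨n, hn⟩ := n
  obtain ⟨k, c, hc, rfl⟩ := Nat.exists_eq_pow_mul_and_not_dvd hn.ne' p hp.out.ne_one
  have hpc : p.Coprime c := (Nat.Prime.coprime_iff_not_dvd hp.out).2 hc
  have hc0 : 0 < c := Nat.pos_of_mul_pos_left hn
  let e := ZMod.chineseRemainder (hpc.pow_left k)
  apply e.injective
  have h1 : ZMod.castHom (dvd_mul_right (p ^ k) c) (ZMod (p ^ k)) (toZMod ⟨p ^ k * c, hn⟩ s) = 0 := by
    refine (castHom_toZMod (m := ⟨p ^ k, pow_pos hp.out.pos k⟩) _ s).trans ?_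
    change toZModPow p k s = 0
    rw [← toZModPow_toPadicInt, hs, map_zero]
  have h2 : ZMod.castHom (dvd_mul_left c (p ^ k)) (ZMod c) (toZMod ⟨p ^ k * c, hn⟩ s) = 0 :=
    (castHom_toZMod (m := ⟨c, hc0⟩) _ s).trans (hm ⟨c, hc0⟩ hpc)
  refine Eq.trans (Prod.ext (Eq.trans ?_ h1) (Eq.trans ?_ h2)) (map_zero e).symm
  · exact RingHom.congr_fun (Subsingleton.elim ((RingHom.fst _ _).comp e.toRingHom) _) _
  · exact RingHom.congr_fun (Subsingleton.elim ((RingHom.snd _ _).comp e.toRingHom) _) _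

/-- There is a profinite integer with prescribed `p`-adic component, congruent to `ε` modulo all
integers prime to `p`. -/
theorem exists_toPadicInt_eq (y : ℤ_[p]) (ε : ℕ) :
    ∃ x : ZHat, toPadicInt p x = y ∧ ∀ m : ℕ+, p.Coprime m → toZMod m x = ε := by
  have hcop : ∀ n : ℕ+, (p ^ (n : ℕ).factorization p).Coprime (n / p ^ (n : ℕ).factorization p) :=
    fun n => (Nat.coprime_ordCompl hp.out n.ne_zero).pow_left _
  -- Coordinate `n` glues the approximation of `y` modulo the `p`-part of `n` with `ε` modulo the
  -- prime-to-`p` part.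
  let k : ℕ+ → ℕ := fun n =>
    (Nat.chineseRemainder (hcop n) (y.appr ((n : ℕ).factorization p)) ε : ℕ)
  have hk1 : ∀ n : ℕ+, k n ≡ y.appr ((n : ℕ).factorization p) [MOD p ^ (n : ℕ).factorization p] :=
    fun n => (Nat.chineseRemainder (hcop n) _ _).2.1
  have hk2 : ∀ n : ℕ+, k n ≡ ε [MOD n / p ^ (n : ℕ).factorization p] :=
    fun n => (Nat.chineseRemainder (hcop n) _ _).2.2
  have happr : ∀ i j : ℕ, i ≤ j → y.appr j ≡ y.appr i [MOD p ^ i] := fun i j h =>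
    ((Nat.modEq_iff_dvd' (y.appr_mono h)).2 (y.dvd_appr_sub_appr i j h)).symm
  refine ⟨⟨fun n => k n, fun m n h => ?_⟩, ?_, fun m hm => ?_⟩
  · rw [map_natCast, ZMod.natCast_eq_natCast_iff]
    have hv : (m : ℕ).factorization p ≤ (n : ℕ).factorization p :=
      (Nat.factorization_le_iff_dvd m.ne_zero n.ne_zero).2 h p
    have hmn := (Nat.modEq_and_modEq_iff_modEq_mul (hcop m) (a := k n) (b := k m)).1
      ⟨(((hk1 n).of_dvd (pow_dvd_pow p hv)).trans (happr _ _ hv)).trans (hk1 m).symm,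
        ((hk2 n).of_dvd (Nat.ordCompl_dvd_ordCompl_of_dvd h p)).trans (hk2 m).symm⟩
    rwa [Nat.ordProj_mul_ordCompl_eq_self] at hmn
  · rw [← PadicInt.ext_of_toZModPow]
    intro j
    rw [toZModPow_toPadicInt]
    have h := hk1 ⟨p ^ j, pow_pos hp.out.pos j⟩
    rw [PNat.mk_coe, hp.out.factorization_pow, Finsupp.single_eq_same] at h
    exact (ZMod.natCast_eq_natCast_iff _ _ _).2 h
  · have h := hk2 m
    rw [Nat.factorization_eq_zero_of_not_dvd ((Nat.Prime.coprime_iff_not_dvd hp.out).1 hm),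
      pow_zero, Nat.div_one] at h
    exact (ZMod.natCast_eq_natCast_iff _ _ _).2 h

end ZHat

/-! ### Closed subgroups of `GL₂` of the profinite integers -/

namespace GL2ZHat

theorem map_castHom_map_toZMod {m n : ℕ+} (h : (m : ℕ) ∣ n) (g : GL (Fin 2) ZHat) :
    Matrix.GeneralLinearGroup.map (ZMod.castHom h (ZMod (m : ℕ)))
      (Matrix.GeneralLinearGroup.map (ZHat.toZMod n) g) =
    Matrix.GeneralLinearGroup.map (ZHat.toZMod m) g :=
  Units.ext (Matrix.ext fun _ _ => ZHat.castHom_toZMod h _)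

/-- Both `y` and `y⁻¹` are lifted to matrices that are the identity away from `p`. The lifts are
mutually inverse, which can be checked at `p` and away from `p`. -/
theorem proj_surjective (p : ℕ) [hp : Fact p.Prime] : Function.Surjective (proj p) := by
  have lift : ∀ y : Matrix (Fin 2) (Fin 2) ℤ_[p], ∃ X : Matrix (Fin 2) (Fin 2) ZHat,
      (ZHat.toPadicInt p).mapMatrix X = y ∧
      ∀ m : ℕ+, p.Coprime m → (ZHat.toZMod m).mapMatrix X = 1 := fun y => by
    choose X hX hX' using fun i j : Fin 2 =>
      ZHat.exists_toPadicInt_eq p (y i j) (if i = j then 1 else 0)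
    refine ⟨Matrix.of X, by ext i j; simp [hX], fun m hm => ?_⟩
    ext i j
    simp [hX' i j m hm, Matrix.one_apply]
  have cancel : ∀ X Y : Matrix (Fin 2) (Fin 2) ZHat,
      (ZHat.toPadicInt p).mapMatrix X * (ZHat.toPadicInt p).mapMatrix Y = 1 →
      (∀ m : ℕ+, p.Coprime m → (ZHat.toZMod m).mapMatrix X = 1) →
      (∀ m : ℕ+, p.Coprime m → (ZHat.toZMod m).mapMatrix Y = 1) → X * Y = 1 := by
    intro X Y hXY hX hY
    refine sub_eq_zero.1 ?_
    ext1 i j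
    refine ZHat.eq_zero_of_toPadicInt_eq_zero p ?_ fun m hm => ?_
    · have h : (ZHat.toPadicInt p).mapMatrix (X * Y - 1) = 0 := by
        rw [map_sub, map_mul, hXY, map_one, sub_self]
      exact congrFun (congrFun h i) j
    · have h : (ZHat.toZMod m).mapMatrix (X * Y - 1) = 0 := by
        rw [map_sub, map_mul, hX m hm, hY m hm, map_one, mul_one, sub_self]
      exact congrFun (congrFun h i) j
  intro y
  obtain ⟨X, hX, hX'⟩ := lift y.1
  obtain ⟨Y, hY, hY'⟩ := lift y⁻¹.1
  exact ⟨⟨X, Y, cancel X Y (by rw [hX, hY, ← Units.val_mul, mul_inv_cancel, Units.val_one]) hX' hY',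
    cancel Y X (by rw [hX, hY, ← Units.val_mul, inv_mul_cancel, Units.val_one]) hY' hX'⟩,
    Units.ext hX⟩

theorem sgn_upper_one : sgn (GL2.upper 1) = -1 := by
  change GL2F2.sgn (Matrix.GeneralLinearGroup.map (ZHat.toZMod 2) (GL2.upper 1)) = -1
  rw [GL2.map_upper, map_one]
  exact GL2.sgn_upper_one

theorem sgn_diagOne (u : ZHatˣ) : sgn (GL2.diagOne u) = 1 := by
  have h : ∀ v : (ZMod 2)ˣ, GL2F2.sgn (GL2.diagOne v) = 1 := by decide
  change GL2F2.sgn (Matrix.GeneralLinearGroup.map (ZHat.toZMod 2) (GL2.diagOne u)) = 1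
  rw [GL2.map_diagOne]
  exact h _

theorem sgnDet_surjective : Function.Surjective sgnDet := by
  rintro ⟨s, d⟩
  rcases Int.units_eq_one_or s with rfl | rfl
  · exact ⟨GL2.diagOne d, Prod.ext (sgn_diagOne d) (GL2.det_diagOne d)⟩
  · refine ⟨GL2.upper 1 * GL2.diagOne d, Prod.ext ?_ ?_⟩
    · change sgn _ = -1
      rw [map_mul, sgn_upper_one, sgn_diagOne, mul_one]
    · change Matrix.GeneralLinearGroup.det _ = d
      rw [map_mul, GL2.det_upper, GL2.det_diagOne, one_mul]

open scoped Nat Topology in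
open Filter in
/-- A closed subgroup contains every element that it meets modulo every integer. -/
theorem mem_of_forall_map_eq {H : Subgroup (GL (Fin 2) ZHat)}
    (hH : IsClosed (H : Set (GL (Fin 2) ZHat))) (x : GL (Fin 2) ZHat)
    (h : ∀ m : ℕ+, ∃ y ∈ H, Matrix.GeneralLinearGroup.map (ZHat.toZMod m) y =
      Matrix.GeneralLinearGroup.map (ZHat.toZMod m) x) : x ∈ H := by
  choose y hy hyx using h
  -- Along factorials, `z j` agrees with `x` modulo every `n ≤ j`, so the sequence converges to `x`.
  let z : ℕ → GL (Fin 2) ZHat := fun j => y ⟨j !, Nat.factorial_pos j⟩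
  have hz : ∀ (n : ℕ+) (j : ℕ), (n : ℕ) ≤ j → Matrix.GeneralLinearGroup.map (ZHat.toZMod n) (z j) =
      Matrix.GeneralLinearGroup.map (ZHat.toZMod n) x := fun n j hj => by
    have hd : (n : ℕ) ∣ ((⟨j !, Nat.factorial_pos j⟩ : ℕ+) : ℕ) := Nat.dvd_factorial n.pos hj
    exact (map_castHom_map_toZMod hd _).symm.trans
      ((congrArg _ (hyx _)).trans (map_castHom_map_toZMod hd x))
  have htend : ∀ (w : ℕ → GL (Fin 2) ZHat) (x : GL (Fin 2) ZHat),
      (∀ (n : ℕ+) (j : ℕ), (n : ℕ) ≤ j → Matrix.GeneralLinearGroup.map (ZHat.toZMod n) (w j) =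
        Matrix.GeneralLinearGroup.map (ZHat.toZMod n) x) →
      Tendsto (fun j => (w j).1) atTop (𝓝 x.1) := by
    intro w x hw
    refine tendsto_pi_nhds.2 fun i => tendsto_pi_nhds.2 fun k => ?_
    refine tendsto_subtype_rng.2 (tendsto_pi_nhds.2 fun n => ?_)
    refine tendsto_const_nhds.congr' ?_
    filter_upwards [eventually_ge_atTop (n : ℕ)] with j hj
    exact (congrArg (fun g : GL (Fin 2) (ZMod (n : ℕ)) => g.1 i k) (hw n j hj)).symm
  have hlim : Tendsto z atTop (𝓝 x) := by
    -- The topology on units also requires the inverses to converge.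
    rw [Units.isInducing_embedProduct.tendsto_nhds_iff]
    refine (htend z x hz).prodMk_nhds ?_
    refine (MulOpposite.continuous_op.tendsto _).comp
      (htend (fun j => (z j)⁻¹) x⁻¹ fun n j hj => ?_)
    rw [map_inv, map_inv, hz n j hj]
  exact hH.mem_of_tendsto hlim (Eventually.of_forall fun j => hy _)

/-- Condition (ii) gives an element of `H` whose reduction has the determinant of `x` and, for even
`m`, its sign; the quotient is then a product of commutators. -/
theorem sup_commutator_eq_top {H : Subgroup (GL (Fin 2) ZHat)}
    (hH : Function.Surjective (sgnDet.comp H.subtype)) (m : ℕ+) :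
    H.map (Matrix.GeneralLinearGroup.map (ZHat.toZMod m)) ⊔ commutator (GL (Fin 2) (ZMod (m : ℕ))) =
      ⊤ := by
  rw [eq_top_iff]
  intro x _
  obtain ⟨d, hd⟩ := ZHat.unitsMap_toZMod_surjective m (Matrix.GeneralLinearGroup.det x)
  -- For odd `m` there is no sign to match, and the value `1` is arbitrary.
  obtain ⟨s, hs⟩ : ∃ s : ℤˣ, ∀ h : 2 ∣ (m : ℕ),
      GL2F2.sgn (Matrix.GeneralLinearGroup.map (ZMod.castHom h (ZMod 2)) x) = s := by
    by_cases h : 2 ∣ (m : ℕ)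
    · exact ⟨GL2F2.sgn (Matrix.GeneralLinearGroup.map (ZMod.castHom h (ZMod 2)) x), fun _ => rfl⟩
    · exact ⟨1, fun h' => absurd h' h⟩
  obtain ⟨⟨g, hg⟩, hgsd⟩ := hH (s, d)
  have hgs : GL2F2.sgn (Matrix.GeneralLinearGroup.map (ZHat.toZMod 2) g) = s :=
    congrArg Prod.fst hgsd
  have hgd : Matrix.GeneralLinearGroup.det g = d := congrArg Prod.snd hgsd
  set f := Matrix.GeneralLinearGroup.map (n := Fin 2) (ZHat.toZMod m) with hf
  have hmem : (f g)⁻¹ * x ∈ commutator (GL (Fin 2) (ZMod (m : ℕ))) := by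
    apply GL2.mem_commutator_of_det_eq_one
    · rw [map_mul, map_inv, hf, Matrix.GeneralLinearGroup.map_det, hgd, inv_mul_eq_one]
      exact hd
    · intro h
      rw [map_mul, map_inv, map_mul, map_inv, hs h, inv_mul_eq_one, ← hgs]
      exact congrArg GL2F2.sgn (map_castHom_map_toZMod (m := 2) h g)
  have := Subgroup.mul_mem_sup (Subgroup.mem_map_of_mem f hg) hmem
  rwa [mul_inv_cancel_left] at this

theorem map_toZMod_eq_top {H : Subgroup (GL (Fin 2) ZHat)}
    (hp : ∀ (p : ℕ) [Fact p.Prime], Function.Surjective ((proj p).comp H.subtype))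
    (hH : Function.Surjective (sgnDet.comp H.subtype)) (m : ℕ) :
    ∀ hm : 0 < m, H.map (Matrix.GeneralLinearGroup.map (ZHat.toZMod ⟨m, hm⟩)) = ⊤ := by
  induction m using Nat.recOnPrimePow with
  | zero => exact fun hm => absurd hm (lt_irrefl 0)
  | one =>
    intro hm
    have : Subsingleton (GL (Fin 2) (ZMod 1)) :=
      ⟨fun a b => Units.ext (Matrix.ext fun i j => Subsingleton.elim _ _)⟩
    exact eq_top_iff.2 fun x _ => ⟨1, H.one_mem, Subsingleton.elim (α := GL (Fin 2) (ZMod 1)) _ _⟩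
  | prime_pow_mul a p n hpp hpa hn ih =>
    intro hm
    have : Fact p.Prime := ⟨hpp⟩
    have ha : 0 < a := Nat.pos_of_mul_pos_left hm
    have hcop : (p ^ n).Coprime a := ((Nat.Prime.coprime_iff_not_dvd hpp).2 hpa).pow_left n
    have hA : NoPerfectQuotient (GL (Fin 2) (ZMod (p ^ n))) := by
      obtain ⟨k, rfl⟩ := Nat.exists_eq_succ_of_ne_zero hn.ne'
      exact GL2.noPerfectQuotient_prime_pow p k
    refine hA.eq_top_of_map_eq_top
      (Matrix.GeneralLinearGroup.map (ZMod.castHom (dvd_mul_right (p ^ n) a) (ZMod (p ^ n))))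
      (Matrix.GeneralLinearGroup.map (ZMod.castHom (dvd_mul_left a (p ^ n)) (ZMod a)))
      (GL2.eq_one_of_map_castHom_eq_one hcop) (GL2.exists_map_castHom_eq hcop) ?_ ?_
      (sup_commutator_eq_top hH ⟨p ^ n * a, hm⟩)
    · rw [eq_top_iff]
      intro x _
      -- Condition (i) applies after lifting `x` to `GL₂(ℤ_[p])`.
      obtain ⟨y, rfl⟩ := GL2.map_toZModPow_surjective p hn x
      obtain ⟨⟨h, hh⟩, rfl⟩ := hp p y
      refine ⟨_, ⟨h, hh, rfl⟩, Units.ext (Matrix.ext fun i j => ?_)⟩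
      exact (ZHat.castHom_toZMod (m := ⟨p ^ n, pow_pos hpp.pos n⟩) (n := ⟨p ^ n * a, hm⟩)
        (dvd_mul_right _ _) _).trans
        (ZHat.toZModPow_toPadicInt p n _).symm
    · refine eq_top_iff.2 fun x _ => ?_
      obtain ⟨h, hh, rfl⟩ := Subgroup.mem_map.1 ((ih ha).symm ▸ Subgroup.mem_top x)
      exact ⟨_, ⟨h, hh, rfl⟩,
        map_castHom_map_toZMod (m := ⟨a, ha⟩) (n := ⟨p ^ n * a, hm⟩) (dvd_mul_left _ _) h⟩

end GL2ZHat

theorem theorem1p1 (H : Subgroup (GL (Fin 2) ZHat))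
    (hH : IsClosed (H : Set (GL (Fin 2) ZHat))) :
    H = ⊤ ↔
      (∀ (p : ℕ) [Fact p.Prime], Function.Surjective ((GL2ZHat.proj p).comp H.subtype)) ∧
      Function.Surjective (GL2ZHat.sgnDet.comp H.subtype) := by
  constructor
  · rintro rfl
    refine ⟨fun p _ y => ?_, fun y => ?_⟩
    · obtain ⟨x, hx⟩ := GL2ZHat.proj_surjective p y
      exact ⟨⟨x, Subgroup.mem_top x⟩, hx⟩
    · obtain ⟨x, hx⟩ := GL2ZHat.sgnDet_surjective y
      exact ⟨⟨x, Subgroup.mem_top x⟩, hx⟩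
  · rintro ⟨hp, hsd⟩
    refine eq_top_iff.2 fun x _ => GL2ZHat.mem_of_forall_map_eq hH x fun m => ?_
    have h := GL2ZHat.map_toZMod_eq_top hp hsd m m.pos
    obtain ⟨y, hy, hyx⟩ := Subgroup.mem_map.1
      (h ▸ Subgroup.mem_top (Matrix.GeneralLinearGroup.map (ZHat.toZMod m) x))
    exact ⟨y, hy, hyx⟩
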